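/- Let $M$ be a smooth oriented 3-manifold with $\pi_1(M)=\pi_2(M)=1$ (so $M$ is connected). For $n\ge 0$ let $X_n$ be the set of oriented knots in $M$ with $n$ transverse double points, up to direction-preserving rigid-vertex isotopy. Let $X_n^0$ be the analogous set of singular knots with double points ordered from $1$ to $n$, up to order-preserving isotopy. Let $X_n^b$ be the analogous set of singular knots with a base point away from the double points, up to base-point-preserving isotopy; here the double points are ordered as they are first met from the base point. For $X=X^0$ or $X=X^b$ let $C_n(X)$ be the $\mathbf{Q}$-vector space with basis $X^0_n$ or $X^b_n$, respectively, with boundary $$\partial K=\sum_{i=1}^{n}(-1)^{i+1}\mathrm{d}_iK,\qquad \mathrm{d}_iK=K_{\times\ldots\underset{i}{+}\ldots\times}-K_{\times\ldots\underset{i}{-}\ldots\times},$$ where $\pm$ denotes the positive and negative resolution of the $i$-th double point, with the induced order and base point. This is the cellular chain complex of the cubical complex $CK_0$ (for $X^0$) or $CK_b$ (for $X^b$). For $n\ge 1$ let $C_n(D)$ be spanned by the degenerate generators $K$, those with $\mathrm{d}_iK=0$ in $C_{n-1}(X)$ for some $i$, and let $C_0(D)=0$. Write $CK$ for either $CK_0$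 or $CK_b$, and let $H^*(CK,D)$ be the cohomology of the cochain complex $C^n(CK,D)=\mathrm{Hom}_{\mathbf{Q}}(C_n(X)/C_n(D),\mathbf{Q})$. A knot invariant $\phi:X_0\to\mathbf{Q}$ is extended to maps $\phi:X_n\to\mathbf{Q}$ for all $n$ by the skein relation $\phi(K_{\times\ldots\times\ldots\times})=\phi(K_{\times\ldots+\ldots\times})-\phi(K_{\times\ldots-\ldots\times})$, and it is a Vassiliev invariant of order at most $N$ if its extension vanishes on $X_{N+1}$. By forgetting the order or the base point, the restriction of $\phi$ to $n$-singular knots is regarded as a cochain of $CK$ of degree $n$. **Theorem.** For every $N\ge 0$, every Vassiliev invariant $\phi$ of order at most $N$, every $k\ge 0$, and both $CK=CK_0$ and $CK=CK_b$, the restriction of $\phi$ to $(2k+1)$-singular knots is a cocycle in $C^{2k+1}(CK,D)$, and its class $[\phi]$ in $H^{2k+1}(CK,D)$ is zero. -/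

import Mathlib

open scoped Manifold ContDiff Topology

noncomputable section

namespace KnotComplex

universe u

/-! ### Oriented 3-manifolds and their isotopies -/

/-- Euclidean 3-space, the model space of 3-manifolds. -/
abbrev E3 : Type := EuclideanSpace ℝ (Fin 3)

/-- The atlas of `M` is oriented: all its transition maps have positive Jacobian determinant.
A smooth 3-manifold with such an atlas is an oriented 3-manifold (without boundary). -/
class OrientedAtlas (M : Type u) [TopologicalSpace M] [ChartedSpace E3 M] : Prop where
  det_pos : ∀ e ∈ atlas E3 M, ∀ e' ∈ atlas E3 M, ∀ x ∈ (e.symm.trans e').source,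
    0 < (fderiv ℝ (e.symm.trans e') x).det

section
variable {M : Type u} [TopologicalSpace M] [ChartedSpace E3 M]

/-- `θ` is the end of an ambient isotopy of `M`: a level-preserving diffeomorphism `Θ` of `ℝ × M`
which is the identity at time `0` and `θ` at time `1`. -/
def IsotopicToIdentity (θ : M → M) : Prop :=
  ∃ Θ : Diffeomorph (𝓘(ℝ, ℝ).prod (𝓡 3)) (𝓘(ℝ, ℝ).prod (𝓡 3)) (ℝ × M) (ℝ × M) ∞,
    (∀ p, (Θ p).1 = p.1) ∧ (∀ x, Θ (0, x) = (0, x)) ∧ ∀ x, Θ (1, x) = (1, θ x)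

theorem IsotopicToIdentity.id : IsotopicToIdentity (id : M → M) :=
  ⟨Diffeomorph.refl _ _ _, fun _ => rfl, fun _ => rfl, fun _ => rfl⟩

theorem IsotopicToIdentity.comp {θ θ' : M → M} (h : IsotopicToIdentity θ)
    (h' : IsotopicToIdentity θ') : IsotopicToIdentity (θ' ∘ θ) := by
  obtain ⟨Θ, h1, h2, h3⟩ := h
  obtain ⟨Θ', h1', h2', h3'⟩ := h'
  exact ⟨Θ.trans Θ', fun p => by simp [h1, h1'], fun x => by simp [h2, h2'],
    fun x => by simp [h3, h3']⟩

theorem IsotopicToIdentity.symm {θ : M → M} (h : IsotopicToIdentity θ) :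
    ∃ θ', IsotopicToIdentity θ' ∧ ∀ x, θ' (θ x) = x := by
  obtain ⟨Θ, h1, h2, h3⟩ := h
  refine ⟨fun x => (Θ.symm (1, x)).2, ⟨Θ.symm, ?_, ?_, ?_⟩, ?_⟩
  · intro p
    have := h1 (Θ.symm p)
    simpa using this.symm
  · intro x
    exact Θ.toEquiv.symm_apply_eq.2 (h2 x).symm
  · intro x
    have := h1 (Θ.symm (1, x))
    refine Prod.ext ?_ rfl
    simpa using this.symm
  · intro x
    have : Θ.symm (1, θ x) = (1, x) := by rw [← h3]; simp
    simp [this]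

end

/-! ### Standard local pictures -/

/-- The unit vector `e_x` (for `true`) or `e_y` (for `false`). Inside the coordinate ball of a double
point, the two branches of a singular knot run along these two axes in the positive direction. -/
def axis (b : Bool) : E3 := EuclideanSpace.single (if b then 0 else 1) 1
/-- The unit vector `e_z`. -/
def vertical : E3 := EuclideanSpace.single 2 1
/-- `true` stands for `+1` and `false` for `-1`. -/
def sgn (b : Bool) : ℝ := if b then 1 else -1
/-- A smooth function on the line with values in `[0, 1]`, equal to `1` near `0` and supported in
`[-1/2, 1/2]`. -/
def bump : ContDiffBump (0 : ℝ) := ⟨1 / 4, 1 / 2, by norm_num, by norm_num⟩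
/-- The resolved branches in the standard ball. In the `ε = true` (positive) resolution the
`x`-branch is pushed up and the `y`-branch is pushed down near the origin, so that
(over-tangent, under-tangent, upward) is the positively oriented frame `(e_x, e_y, e_z)`: a positive
crossing. In the `ε = false` (negative) resolution the pushes are reversed. -/
def strand (ε b : Bool) (u : ℝ) : E3 :=
  u • axis b + (sgn ε * sgn b * (bump u / 2)) • vertical
/-- For `w = true`, the rotation by a half turn about the line `x = y`, `z = 0`; for `w = false` the
identity. These are the orientation-preserving symmetries of the standard vertex: the half turn
exchanges the two branches and preserves their directions. -/
def halfTurn (w : Bool) (v : E3) : E3 := if w then !₂[v 1, v 0, -v 2] else v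

theorem strand_apply_axis (ε b : Bool) (u : ℝ) :
    strand ε b u (if b then 0 else 1) = u := by
  cases b <;> simp [strand, axis, vertical]

theorem strand_apply_two (ε b : Bool) (u : ℝ) :
    strand ε b u 2 = sgn ε * sgn b * (bump u / 2) := by
  cases b <;> simp [strand, axis, vertical]

theorem strand_apply_not (ε b : Bool) (u : ℝ) :
    strand ε b u (if b then 1 else 0) = 0 := by
  cases b <;> simp [strand, axis, vertical]

theorem strand_of_half_le (ε b : Bool) {u : ℝ} (hu : 1 / 2 ≤ |u|) :
    strand ε b u = u • axis b := by
  have : bump u = 0 := bump.zero_of_le_dist (by simpa [bump] using hu)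
  simp [strand, this]

theorem norm_axis_smul (b : Bool) (u : ℝ) : ‖u • axis b‖ = |u| := by
  cases b <;> simp [axis, norm_smul]

theorem axis_smul_injective {b b' : Bool} {u u' : ℝ} (h : u • axis b = u' • axis b') :
    u = u' ∧ (b = b' ∨ u = 0) := by
  have h0 := congrArg (fun v : E3 => v 0) h
  have h1 := congrArg (fun v : E3 => v 1) h
  cases b <;> cases b' <;> simp [axis] at h0 h1 ⊢
  · exact h1
  · exact ⟨by rw [h1, ← h0], h1⟩
  · exact ⟨by rw [h0, ← h1], h0⟩
  · exact h0

theorem strand_mem (ε b : Bool) {u : ℝ} (hu : u ∈ Set.Icc (-1 : ℝ) 1) :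
    strand ε b u ∈ Metric.closedBall (0 : E3) 1 := by
  have hu' : |u| ≤ 1 := abs_le.2 hu
  rw [mem_closedBall_zero_iff]
  by_cases h : 1 / 2 ≤ |u|
  · rwa [strand_of_half_le _ _ h, norm_axis_smul]
  · have h1 : ‖u • axis b‖ ≤ 1 / 2 := by rw [norm_axis_smul]; linarith
    have h2 : ‖(sgn ε * sgn b * (bump u / 2)) • vertical‖ ≤ 1 / 2 := by
      have a := bump.nonneg (x := u)
      have b' := bump.le_one (x := u)
      have : |sgn ε * sgn b * (bump u / 2)| ≤ 1 / 2 := by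
        rw [abs_le]
        cases ε <;> cases b <;> simp [sgn] <;> constructor <;> linarith
      rw [norm_smul, Real.norm_eq_abs]
      simpa only [vertical, PiLp.norm_single, norm_one, mul_one] using this
    unfold strand
    refine (norm_add_le _ _).trans (by linarith)

theorem strand_injective {ε b b' : Bool} {u u' : ℝ} (h : strand ε b u = strand ε b' u') :
    b = b' ∧ u = u' := by
  have hb : b = b' := by
    by_contra hne
    have hb' : b' = !b := by cases b <;> cases b' <;> simp_all
    subst hb'
    have e1 := congrArg (fun v : E3 => v (if b then 0 else 1)) h
    have e2 := congrArg (fun v : E3 => v (if b then 1 else 0)) h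
    have e3 := congrArg (fun v : E3 => v 2) h
    simp only [strand_apply_axis, strand_apply_not, strand_apply_two] at e1 e2 e3
    have n1 := strand_apply_not ε (!b) u'
    have n2 := strand_apply_axis ε (!b) u'
    have hu : u = 0 := by cases b <;> simp_all
    have hu' : u' = 0 := by cases b <;> simp_all
    subst hu hu'
    have hb0 : bump (0 : ℝ) = 1 := bump.one_of_mem_closedBall (by simp [bump])
    cases ε <;> cases b <;> simp [sgn, hb0] at e3 <;> linarith
  subst hb
  refine ⟨rfl, ?_⟩
  have := congrArg (fun v : E3 => v (if b then 0 else 1)) h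
  simpa only [strand_apply_axis] using this

theorem halfTurn_strand (w ε b : Bool) (u : ℝ) :
    halfTurn w (strand ε b u) = strand ε (xor b w) u := by
  cases w
  · simp [halfTurn]
  · ext j
    fin_cases j <;> cases b <;> cases ε <;>
      simp [halfTurn, strand, axis, vertical, sgn]

theorem halfTurn_axis (w b : Bool) (u : ℝ) :
    halfTurn w (u • axis b) = u • axis (xor b w) := by
  cases w
  · simp [halfTurn]
  · ext j
    fin_cases j <;> cases b <;> simp [halfTurn, axis]

theorem halfTurn_halfTurn (w w' : Bool) (v : E3) :
    halfTurn w (halfTurn w' v) = halfTurn (xor w' w) v := by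
  cases w <;> cases w' <;> simp [halfTurn]
  ext j; fin_cases j <;> simp

theorem halfTurn_mem (w : Bool) {v : E3} (hv : v ∈ Metric.closedBall (0 : E3) 1) :
    halfTurn w v ∈ Metric.closedBall (0 : E3) 1 := by
  cases w
  · simpa [halfTurn] using hv
  · rw [mem_closedBall_zero_iff] at *
    have : ‖halfTurn true v‖ = ‖v‖ := by
      simp [halfTurn, EuclideanSpace.norm_eq, Fin.sum_univ_three, add_comm]
    rwa [this]

theorem contDiff_strand (ε b : Bool) : ContDiff ℝ ∞ (strand ε b) := by
  unfold strand
  have : ContDiff ℝ ∞ (bump : ℝ → ℝ) := bump.contDiff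
  fun_prop


/-! ### Singular knots -/

section
variable (M : Type u) [TopologicalSpace M] [ChartedSpace E3 M]

/-- An oriented knot in `M` with exactly `n` transverse double points, which are labelled by `Fin n`
and rigid: a smooth immersion of the circle `ℝ / ℤ`, written as a `1`-periodic map on the line,
together with coordinate balls at the double points. The balls are images of the closed unit ball
under orientation-preserving smooth open embeddings `ball i : ℝ³ → M`; they are pairwise disjoint,
the centre of the `i`-th one is the `i`-th double point, and the knot meets the `i`-th ball exactly in
the images of the `x`-axis and the `y`-axis. `arc i b` is a parametrization of the branch `b` at the
`i`-th double point, so `arc i true 0` and `arc i false 0` are the two preimages of that point.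
There are no other self-intersections. For `n = 0` this is a smooth oriented knot. Coordinate balls
exist around the double points of every immersion with transverse double points, and they can be
chosen as small as one likes. -/
@[ext]
structure SingularKnot (n : ℕ) where
  curve : ℝ → M
  periodic : ∀ s, curve (s + 1) = curve s
  smooth : ContMDiff 𝓘(ℝ, ℝ) (𝓡 3) ∞ curve
  immersed : ∀ s, mfderiv 𝓘(ℝ, ℝ) (𝓡 3) curve s ≠ 0
  ball : Fin n → E3 → M
  ball_localDiffeo : ∀ i, IsLocalDiffeomorph (𝓡 3) (𝓡 3) ∞ (ball i)
  ball_injective : ∀ i, Function.Injective (ball i)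
  ball_oriented : ∀ i v, 0 < (mfderiv (𝓡 3) (𝓡 3) (ball i) v : E3 →L[ℝ] E3).det
  ball_disjoint : ∀ i j, i ≠ j →
    Disjoint (ball i '' Metric.closedBall 0 1) (ball j '' Metric.closedBall 0 1)
  arc : Fin n → Bool → Diffeomorph 𝓘(ℝ, ℝ) 𝓘(ℝ, ℝ) ℝ ℝ ∞
  arc_strictMono : ∀ i b, StrictMono (arc i b)
  curve_arc : ∀ i b, ∀ u ∈ Set.Icc (-1 : ℝ) 1, curve (arc i b u) = ball i (u • axis b)
  arc_ne : ∀ i, ∀ m : ℤ, arc i true 0 ≠ arc i false 0 + m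
  mem_arc_of_mem_ball : ∀ i s, curve s ∈ ball i '' Metric.closedBall 0 1 →
    ∃ b, ∃ u ∈ Set.Icc (-1 : ℝ) 1, ∃ m : ℤ, s = arc i b u + m
  eq_of_curve_eq : ∀ s t, curve s = curve t → (∃ m : ℤ, s = t + m) ∨
    ∃ i b, ∃ m m' : ℤ, s = arc i b 0 + m ∧ t = arc i (!b) 0 + m'

end

section
variable {M : Type u} [TopologicalSpace M] [ChartedSpace E3 M] {n : ℕ}

namespace SingularKnot

theorem curve_add_int (K : SingularKnot M n) (s : ℝ) (m : ℤ) : K.curve (s + m) = K.curve s := by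
  have : Function.Periodic K.curve 1 := K.periodic
  simpa using this.int_mul m s

theorem smul_axis_mem {b : Bool} {u : ℝ} (hu : u ∈ Set.Icc (-1 : ℝ) 1) :
    u • axis b ∈ Metric.closedBall (0 : E3) 1 := by
  rw [mem_closedBall_zero_iff, norm_axis_smul]; exact abs_le.2 hu

theorem arc_unique (K : SingularKnot M n) {i : Fin n} {b b' : Bool} {u u' : ℝ} {m m' : ℤ}
    (hu : u ∈ Set.Icc (-1 : ℝ) 1) (hu' : u' ∈ Set.Icc (-1 : ℝ) 1)
    (h : K.arc i b u + m = K.arc i b' u' + m') : b = b' ∧ u = u' := by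
  have h1 := congrArg K.curve h
  rw [curve_add_int, curve_add_int, K.curve_arc i b u hu, K.curve_arc i b' u' hu'] at h1
  obtain ⟨h2, h3⟩ := axis_smul_injective (K.ball_injective i h1)
  subst h2
  refine ⟨?_, rfl⟩
  rcases h3 with h3 | h3
  · exact h3
  · subst h3
    by_contra hne
    cases b <;> cases b' <;> simp at hne
    · apply K.arc_ne i (m - m'); push_cast; linarith
    · apply K.arc_ne i (m' - m); push_cast; linarith

open Classical in
/-- The curve with the `i`-th double point resolved: on the two branches in the `i`-th ball the axes
are replaced by the pushed strands, elsewhere the curve is unchanged. -/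
def resolveCurve (K : SingularKnot M n) (i : Fin n) (ε : Bool) (s : ℝ) : M :=
  if h : ∃ p : Bool × ℝ × ℤ, p.2.1 ∈ Set.Icc (-1 : ℝ) 1 ∧ s = K.arc i p.1 p.2.1 + p.2.2 then
    K.ball i (strand ε h.choose.1 h.choose.2.1)
  else K.curve s

theorem resolveCurve_arc (K : SingularKnot M n) (i : Fin n) (ε b : Bool) {u : ℝ} (m : ℤ)
    (hu : u ∈ Set.Icc (-1 : ℝ) 1) :
    K.resolveCurve i ε (K.arc i b u + m) = K.ball i (strand ε b u) := by
  have h : ∃ p : Bool × ℝ × ℤ, p.2.1 ∈ Set.Icc (-1 : ℝ) 1 ∧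
      K.arc i b u + m = K.arc i p.1 p.2.1 + p.2.2 := ⟨(b, u, m), hu, rfl⟩
  rw [resolveCurve, dif_pos h]
  obtain ⟨h1, h2⟩ := K.arc_unique hu h.choose_spec.1 h.choose_spec.2
  rw [← h1, ← h2]

theorem resolveCurve_of_notMem (K : SingularKnot M n) (i : Fin n) (ε : Bool) {s : ℝ}
    (hs : K.curve s ∉ K.ball i '' Metric.closedBall 0 1) :
    K.resolveCurve i ε s = K.curve s := by
  rw [resolveCurve, dif_neg]
  rintro ⟨⟨b, u, m⟩, hu, rfl⟩
  apply hs
  rw [curve_add_int, K.curve_arc i b u hu]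
  exact ⟨_, smul_axis_mem hu, rfl⟩

theorem resolveCurve_mem_iff (K : SingularKnot M n) (i : Fin n) (ε : Bool) (s : ℝ) :
    K.resolveCurve i ε s ∈ K.ball i '' Metric.closedBall 0 1 ↔
      K.curve s ∈ K.ball i '' Metric.closedBall 0 1 := by
  by_cases hs : K.curve s ∈ K.ball i '' Metric.closedBall 0 1
  · obtain ⟨b, u, hu, m, rfl⟩ := K.mem_arc_of_mem_ball i s hs
    rw [resolveCurve_arc _ _ _ _ _ hu]
    exact iff_of_true ⟨_, strand_mem _ _ hu, rfl⟩ hs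
  · rw [K.resolveCurve_of_notMem i ε hs]

theorem resolveCurve_of_mem_other (K : SingularKnot M n) {i j : Fin n} (hij : i ≠ j) (ε : Bool)
    {s : ℝ} (hs : K.curve s ∈ K.ball j '' Metric.closedBall 0 1) :
    K.resolveCurve i ε s = K.curve s :=
  K.resolveCurve_of_notMem i ε fun h =>
    Set.disjoint_left.1 (K.ball_disjoint i j hij) h hs

/-- Near every parameter the resolved curve is either the old curve or a smooth strand in the
coordinate ball of the resolved double point. -/
theorem resolveCurve_local [T2Space M] (K : SingularKnot M n) (i : Fin n) (ε : Bool) (s : ℝ) :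
    (K.resolveCurve i ε =ᶠ[𝓝 s] K.curve) ∨
    ∃ b, ∃ m : ℤ, K.resolveCurve i ε =ᶠ[𝓝 s]
      fun t => K.ball i (strand ε b ((K.arc i b).symm (t - m))) := by
  by_cases hs : K.curve s ∈ K.ball i '' Metric.closedBall 0 (1 / 2)
  · right
    have hs' : K.curve s ∈ K.ball i '' Metric.closedBall 0 1 :=
      Set.image_mono (Metric.closedBall_subset_closedBall (by norm_num)) hs
    obtain ⟨b, u, hu, m, rfl⟩ := K.mem_arc_of_mem_ball i s hs'
    rw [curve_add_int, K.curve_arc i b u hu] at hs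
    obtain ⟨v, hv, hvu⟩ := hs
    have := K.ball_injective i hvu
    subst this
    rw [mem_closedBall_zero_iff, norm_axis_smul, abs_le] at hv
    refine ⟨b, m, ?_⟩
    have hc : ContinuousAt (fun t : ℝ => (K.arc i b).symm (t - m)) (K.arc i b u + m) := by
      have : Continuous (K.arc i b).symm := (K.arc i b).symm.continuous
      fun_prop
    have hm : Set.Ioo (-1 : ℝ) 1 ∈ 𝓝 ((K.arc i b).symm (K.arc i b u + m - m)) := by
      rw [add_sub_cancel_right, Diffeomorph.symm_apply_apply]
      exact Ioo_mem_nhds (by linarith [hv.1]) (by linarith [hv.2])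
    filter_upwards [hc.preimage_mem_nhds hm] with t ht
    have := K.resolveCurve_arc i ε b m (Set.Ioo_subset_Icc_self ht)
    simpa using this
  · left
    have hcl : IsClosed (K.ball i '' Metric.closedBall 0 (1 / 2)) :=
      ((isCompact_closedBall (0 : E3) (1 / 2)).image
        (K.ball_localDiffeo i).contMDiff.continuous).isClosed
    have ho : K.curve ⁻¹' (K.ball i '' Metric.closedBall 0 (1 / 2))ᶜ ∈ 𝓝 s :=
      K.smooth.continuous.continuousAt.preimage_mem_nhds (hcl.isOpen_compl.mem_nhds hs)
    filter_upwards [ho] with t ht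
    by_cases ht' : K.curve t ∈ K.ball i '' Metric.closedBall 0 1
    · obtain ⟨b, u, hu, m, rfl⟩ := K.mem_arc_of_mem_ball i t ht'
      rw [resolveCurve_arc _ _ _ _ _ hu, curve_add_int, K.curve_arc i b u hu, strand_of_half_le]
      by_contra hlt
      apply ht
      rw [curve_add_int, K.curve_arc i b u hu]
      exact ⟨_, by rw [mem_closedBall_zero_iff, norm_axis_smul]; exact (not_le.1 hlt).le, rfl⟩
    · exact K.resolveCurve_of_notMem i ε ht'

theorem contMDiff_strand_ball (K : SingularKnot M n) (i : Fin n) (ε b : Bool) (m : ℤ) :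
    ContMDiff 𝓘(ℝ, ℝ) (𝓡 3) ∞
      fun t : ℝ => K.ball i (strand ε b ((K.arc i b).symm (t - m))) := by
  have h1 : ContMDiff 𝓘(ℝ, ℝ) 𝓘(ℝ, ℝ) ∞ fun t : ℝ => t - (m : ℝ) := by
    rw [contMDiff_iff_contDiff]; fun_prop
  exact (K.ball_localDiffeo i).contMDiff.comp
    ((contDiff_strand ε b).contMDiff.comp ((K.arc i b).symm.contMDiff_toFun.comp h1))

theorem resolveCurve_smooth [T2Space M] (K : SingularKnot M n) (i : Fin n) (ε : Bool) :
    ContMDiff 𝓘(ℝ, ℝ) (𝓡 3) ∞ (K.resolveCurve i ε) := by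
  intro s
  rcases K.resolveCurve_local i ε s with h | ⟨b, m, h⟩
  · exact (K.smooth s).congr_of_eventuallyEq h
  · exact (K.contMDiff_strand_ball i ε b m s).congr_of_eventuallyEq h

theorem resolveCurve_immersed [T2Space M] (K : SingularKnot M n) (i : Fin n) (ε : Bool) (s : ℝ) :
    mfderiv 𝓘(ℝ, ℝ) (𝓡 3) (K.resolveCurve i ε) s ≠ 0 := by
  rcases K.resolveCurve_local i ε s with h | ⟨b, m, h⟩
  · rw [h.mfderiv_eq]; exact K.immersed s
  · rw [h.mfderiv_eq]
    intro h0
    set γ : ℝ → E3 := fun t => strand ε b ((K.arc i b).symm (t - m)) with hγ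
    have hγs : ContMDiff 𝓘(ℝ, ℝ) (𝓡 3) ∞ γ := by
      have h1 : ContMDiff 𝓘(ℝ, ℝ) 𝓘(ℝ, ℝ) ∞ fun t : ℝ => t - (m : ℝ) := by
        rw [contMDiff_iff_contDiff]; fun_prop
      exact (contDiff_strand ε b).contMDiff.comp ((K.arc i b).symm.contMDiff_toFun.comp h1)
    have hγd : MDifferentiableAt 𝓘(ℝ, ℝ) (𝓡 3) γ s := hγs.mdifferentiable (by simp) s
    have hball : MDifferentiableAt (𝓡 3) (𝓡 3) (K.ball i) (γ s) :=
      (K.ball_localDiffeo i).mdifferentiable (by simp) _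
    have hcomp := mfderiv_comp s hball hγd
    have hz : mfderiv 𝓘(ℝ, ℝ) (𝓡 3) γ s = 0 := by
      have he := ((K.ball_localDiffeo i) (γ s)).mfderivToContinuousLinearEquiv_coe (by simp)
      refine ContinuousLinearMap.ext fun x => ?_
      have h2 : mfderiv (𝓡 3) (𝓡 3) (K.ball i) (γ s) (mfderiv 𝓘(ℝ, ℝ) (𝓡 3) γ s x) = 0 := by
        have := congrArg (fun L => L x) (hcomp.symm.trans h0)
        exact this
      rw [← he] at h2
      have h3 := (((K.ball_localDiffeo i) (γ s)).mfderivToContinuousLinearEquiv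
        (by simp)).map_eq_zero_iff.1 h2
      rw [h3]; rfl
    rw [mfderiv_eq_fderiv] at hz
    have hγd' : DifferentiableAt ℝ γ s := hγd.differentiableAt
    have harc : DifferentiableAt ℝ (K.arc i b) (γ s (if b then 0 else 1)) := by
      have : ContDiff ℝ ∞ (K.arc i b) := (K.arc i b).contMDiff_toFun.contDiff
      exact (this.differentiable (by simp)).differentiableAt
    have hl : HasFDerivAt (fun v : E3 => v (if b then 0 else 1))
        (EuclideanSpace.proj (if b then 0 else 1) : E3 →L[ℝ] ℝ) (γ s) :=
      (EuclideanSpace.proj (if b then 0 else 1) : E3 →L[ℝ] ℝ).hasFDerivAt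
    have hγ0 : HasFDerivAt γ (0 : ℝ →L[ℝ] E3) s := hγd'.hasFDerivAt.congr_fderiv hz
    have key := (harc.hasFDerivAt.comp (γ s) hl).comp s hγ0
    have hid : (((K.arc i b) ∘ fun v : E3 => v (if b then 0 else 1)) ∘ γ) = fun t : ℝ => t - m := by
      funext t
      simp only [Function.comp, hγ, strand_apply_axis]
      simp
    rw [hid] at key
    have h1 : HasFDerivAt (fun t : ℝ => t - (m : ℝ)) (ContinuousLinearMap.id ℝ ℝ) s :=
      (hasFDerivAt_id s).sub_const _
    have := congrArg (fun L : ℝ →L[ℝ] ℝ => L 1) (h1.unique key)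
    simp at this

/-- The positive (`ε = true`) or negative (`ε = false`) resolution of the `i`-th double point. The
remaining double points keep their order. -/
def resolve [T2Space M] (K : SingularKnot M (n + 1)) (i : Fin (n + 1)) (ε : Bool) :
    SingularKnot M n where
  curve := K.resolveCurve i ε
  periodic s := by
    by_cases hs : K.curve s ∈ K.ball i '' Metric.closedBall 0 1
    · obtain ⟨b, u, hu, m, rfl⟩ := K.mem_arc_of_mem_ball i s hs
      have := K.resolveCurve_arc i ε b (m + 1) hu
      push_cast at this
      rw [resolveCurve_arc _ _ _ _ _ hu, ← this, add_assoc]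
    · rw [resolveCurve_of_notMem _ _ _ hs, resolveCurve_of_notMem _ _ _ (by rwa [K.periodic]),
        K.periodic]
  smooth := K.resolveCurve_smooth i ε
  immersed := K.resolveCurve_immersed i ε
  ball j := K.ball (i.succAbove j)
  ball_localDiffeo j := K.ball_localDiffeo _
  ball_injective j := K.ball_injective _
  ball_oriented j := K.ball_oriented _
  ball_disjoint j k hjk := K.ball_disjoint _ _ fun h => hjk (Fin.succAbove_right_injective h)
  arc j := K.arc (i.succAbove j)
  arc_strictMono j := K.arc_strictMono _
  curve_arc j b u hu := by
    rw [K.resolveCurve_of_mem_other (Fin.ne_succAbove i j), K.curve_arc _ _ _ hu]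
    rw [K.curve_arc _ _ _ hu]
    exact ⟨_, smul_axis_mem hu, rfl⟩
  arc_ne j := K.arc_ne _
  mem_arc_of_mem_ball j s hs := by
    apply K.mem_arc_of_mem_ball
    by_cases hi : K.curve s ∈ K.ball i '' Metric.closedBall 0 1
    · exact absurd hs (Set.disjoint_left.1 (K.ball_disjoint _ _ (Fin.ne_succAbove i j))
        ((K.resolveCurve_mem_iff i ε s).2 hi))
    · rwa [K.resolveCurve_of_notMem i ε hi] at hs
  eq_of_curve_eq s t h := by
    by_cases hs : K.curve s ∈ K.ball i '' Metric.closedBall 0 1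
    · have ht : K.curve t ∈ K.ball i '' Metric.closedBall 0 1 := by
        rw [← K.resolveCurve_mem_iff i ε, ← h, K.resolveCurve_mem_iff]; exact hs
      left
      obtain ⟨b, u, hu, m, rfl⟩ := K.mem_arc_of_mem_ball i s hs
      obtain ⟨b', u', hu', m', rfl⟩ := K.mem_arc_of_mem_ball i t ht
      rw [resolveCurve_arc _ _ _ _ _ hu, resolveCurve_arc _ _ _ _ _ hu'] at h
      obtain ⟨rfl, rfl⟩ := strand_injective (K.ball_injective i h)
      exact ⟨m - m', by push_cast; ring⟩
    · have ht : K.curve t ∉ K.ball i '' Metric.closedBall 0 1 := by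
        rw [← K.resolveCurve_mem_iff i ε, ← h, K.resolveCurve_mem_iff]; exact hs
      rw [resolveCurve_of_notMem _ _ _ hs, resolveCurve_of_notMem _ _ _ ht] at h
      rcases K.eq_of_curve_eq s t h with h' | ⟨j, b, m, m', h1, h2⟩
      · exact Or.inl h'
      · right
        have hji : j ≠ i := by
          rintro rfl
          apply hs
          rw [h1, curve_add_int, K.curve_arc _ _ _ (by norm_num)]
          exact ⟨_, smul_axis_mem (by norm_num), rfl⟩
        obtain ⟨k, rfl⟩ := Fin.exists_succAbove_eq hji
        exact ⟨k, b, m, m', h1, h2⟩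

end SingularKnot
end

section
variable {M : Type u} [TopologicalSpace M] [ChartedSpace E3 M] {n : ℕ}

namespace SingularKnot

theorem resolve_resolve_curve_aux [T2Space M] (K : SingularKnot M (n + 2)) {a b : Fin (n + 2)}
    {p q : Fin (n + 1)} (hp : a.succAbove p = b) (hq : b.succAbove q = a) (ε δ : Bool) {s : ℝ}
    (hs : K.curve s ∈ K.ball b '' Metric.closedBall 0 1) :
    ((K.resolve a ε).resolve p δ).curve s = K.resolveCurve b δ s ∧
    ((K.resolve b δ).resolve q ε).curve s = K.resolveCurve b δ s := by
  subst hp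
  constructor
  · obtain ⟨c, u, hu, m, rfl⟩ := K.mem_arc_of_mem_ball _ s hs
    rw [K.resolveCurve_arc _ _ _ _ hu]
    exact (K.resolve a ε).resolveCurve_arc p δ c m hu
  · apply (K.resolve (a.succAbove p) δ).resolveCurve_of_notMem q ε
    intro h
    change K.resolveCurve _ δ s ∈ K.ball ((a.succAbove p).succAbove q) '' _ at h
    rw [hq] at h
    exact Set.disjoint_left.1 (K.ball_disjoint _ _ (Fin.ne_succAbove a p)) h
      ((K.resolveCurve_mem_iff _ δ s).2 hs)

theorem resolve_resolve_curve [T2Space M] (K : SingularKnot M (n + 2)) {a b : Fin (n + 2)}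
    {p q : Fin (n + 1)} (hp : a.succAbove p = b) (hq : b.succAbove q = a) (ε δ : Bool) :
    ((K.resolve a ε).resolve p δ).curve = ((K.resolve b δ).resolve q ε).curve := by
  funext s
  by_cases hb : K.curve s ∈ K.ball b '' Metric.closedBall 0 1
  · obtain ⟨h1, h2⟩ := K.resolve_resolve_curve_aux hp hq ε δ hb
    rw [h1, h2]
  by_cases ha : K.curve s ∈ K.ball a '' Metric.closedBall 0 1
  · obtain ⟨h1, h2⟩ := K.resolve_resolve_curve_aux hq hp δ ε ha
    rw [h1, h2]
  have key : ∀ (c d : Fin (n + 2)) (r : Fin (n + 1)) (ε δ : Bool), c.succAbove r = d →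
      K.curve s ∉ K.ball c '' Metric.closedBall 0 1 →
      K.curve s ∉ K.ball d '' Metric.closedBall 0 1 →
      ((K.resolve c ε).resolve r δ).curve s = K.curve s := by
    intro c d r ε δ hr hc hd
    subst hr
    have h1 : (K.resolve c ε).curve s = K.curve s := K.resolveCurve_of_notMem c ε hc
    rw [← h1]
    apply (K.resolve c ε).resolveCurve_of_notMem r δ
    rw [h1]
    exact hd
  rw [key a b p ε δ hp ha hb, key b a q δ ε hq hb ha]

theorem resolve_resolve [T2Space M] (K : SingularKnot M (n + 2)) {i j : Fin (n + 1)} (hij : i ≤ j)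
    (ε δ : Bool) :
    (K.resolve j.succ ε).resolve i δ = (K.resolve i.castSucc δ).resolve j ε := by
  have hk : ∀ k : Fin n, j.succ.succAbove (i.succAbove k) = i.castSucc.succAbove (j.succAbove k) := by
    intro k
    ext
    rcases i with ⟨i, _⟩
    rcases j with ⟨j, _⟩
    rcases k with ⟨k, _⟩
    simp only [Fin.succAbove, Fin.mk_le_mk] at hij ⊢
    split_ifs <;> simp at * <;> lia
  apply SingularKnot.ext
  · refine K.resolve_resolve_curve (Fin.succAbove_succ_of_le j i hij) ?_ ε δ
    exact Fin.succAbove_castSucc_of_le i j hij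
  · funext k
    exact congrArg K.ball (hk k)
  · funext k
    exact congrArg K.arc (hk k)

end SingularKnot

/-! ### Rigid-vertex isotopy -/

/-- A direction-preserving rigid-vertex isotopy from `K` to `K'`, which sends the `i`-th double point of
`K` to the double point of `K'` with label `σ i`: an ambient isotopy with end `θ` which carries the
curve of `K` to that of `K'` up to an orientation-preserving diffeomorphism `ρ` of the circle (given
by its lift to the line), and which carries coordinate balls to coordinate balls rigidly, up to the
half turn that exchanges the two branches of the standard vertex. -/
structure RigidIsotopy (σ : Equiv.Perm (Fin n)) (K K' : SingularKnot M n) where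
  θ : M → M
  isotopic_id : IsotopicToIdentity θ
  ρ : Diffeomorph 𝓘(ℝ, ℝ) 𝓘(ℝ, ℝ) ℝ ℝ ∞
  ρ_strictMono : StrictMono ρ
  ρ_add_one : ∀ s, ρ (s + 1) = ρ s + 1
  map_curve : ∀ s, θ (K.curve s) = K'.curve (ρ s)
  turn : Fin n → Bool
  map_ball : ∀ i, ∀ v ∈ Metric.closedBall (0 : E3) 1,
    θ (K.ball i v) = K'.ball (σ i) (halfTurn (turn i) v)
  map_branch : ∀ i b, ∃ m : ℤ, ρ (K.arc i b 0) = K'.arc (σ i) (xor b (turn i)) 0 + m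

namespace RigidIsotopy

theorem ρ_add_int {σ : Equiv.Perm (Fin n)} {K K' : SingularKnot M n} (T : RigidIsotopy σ K K')
    (s : ℝ) (m : ℤ) : T.ρ (s + m) = T.ρ s + m := by
  have h : Function.Periodic (fun s => T.ρ s - s) 1 := fun s => by simp [T.ρ_add_one]
  have := h.int_mul m s
  simp only [mul_one] at this
  linarith

theorem ρ_symm_add_int {σ : Equiv.Perm (Fin n)} {K K' : SingularKnot M n}
    (T : RigidIsotopy σ K K') (s : ℝ) (m : ℤ) : T.ρ.symm (s + m) = T.ρ.symm s + m := by
  apply T.ρ.injective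
  change T.ρ _ = T.ρ _
  rw [T.ρ_add_int]; simp

theorem map_arc {σ : Equiv.Perm (Fin n)} {K K' : SingularKnot M n} (T : RigidIsotopy σ K K')
    (i : Fin n) (b : Bool) {u : ℝ} (hu : u ∈ Set.Icc (-1 : ℝ) 1) :
    ∃ m : ℤ, T.ρ (K.arc i b u) = K'.arc (σ i) (xor b (T.turn i)) u + m := by
  by_cases h0 : u = 0
  · subst h0; exact T.map_branch i b
  have h := T.map_curve (K.arc i b u)
  rw [K.curve_arc i b u hu, T.map_ball i _ (SingularKnot.smul_axis_mem hu), halfTurn_axis,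
    ← K'.curve_arc _ _ u hu] at h
  rcases K'.eq_of_curve_eq _ _ h.symm with h' | ⟨j, c, m, m', h1, h2⟩
  · exact h'
  · exfalso
    have h3 := congrArg K'.curve h2
    rw [SingularKnot.curve_add_int, K'.curve_arc _ _ _ hu, K'.curve_arc _ _ _ (by norm_num)] at h3
    by_cases hj : σ i = j
    · subst hj
      have := K'.ball_injective _ h3
      obtain ⟨h4, -⟩ := axis_smul_injective this
      exact h0 h4
    · refine Set.disjoint_left.1 (K'.ball_disjoint _ _ hj)
        ⟨u • axis (xor b (T.turn i)), SingularKnot.smul_axis_mem hu, rfl⟩ ?_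
      rw [h3]
      exact ⟨_, SingularKnot.smul_axis_mem (by norm_num), rfl⟩

theorem θ_injective {σ : Equiv.Perm (Fin n)} {K K' : SingularKnot M n} (T : RigidIsotopy σ K K') :
    Function.Injective T.θ := by
  obtain ⟨θ', -, h⟩ := T.isotopic_id.symm
  exact Function.LeftInverse.injective h

def refl (K : SingularKnot M n) : RigidIsotopy 1 K K where
  θ := id
  isotopic_id := IsotopicToIdentity.id
  ρ := Diffeomorph.refl _ _ _
  ρ_strictMono := strictMono_id
  ρ_add_one _ := rfl
  map_curve _ := rfl
  turn _ := false
  map_ball i v _ := by simp [halfTurn]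
  map_branch i b := ⟨0, by simp⟩

def symm {σ : Equiv.Perm (Fin n)} {K K' : SingularKnot M n} (T : RigidIsotopy σ K K') :
    RigidIsotopy σ⁻¹ K' K where
  θ := T.isotopic_id.symm.choose
  isotopic_id := T.isotopic_id.symm.choose_spec.1
  ρ := T.ρ.symm
  ρ_strictMono a b h := by
    rw [← T.ρ_strictMono.lt_iff_lt]; simpa using h
  ρ_add_one s := by simpa using T.ρ_symm_add_int s 1
  map_curve s := by
    have h := T.map_curve (T.ρ.symm s)
    rw [Diffeomorph.apply_symm_apply] at h
    rw [← h, T.isotopic_id.symm.choose_spec.2]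
  turn i := T.turn (σ⁻¹ i)
  map_ball i v hv := by
    have h := T.map_ball (σ⁻¹ i) (halfTurn (T.turn (σ⁻¹ i)) v) (halfTurn_mem _ hv)
    have h2 : halfTurn (T.turn (σ⁻¹ i)) (halfTurn (T.turn (σ⁻¹ i)) v) = v := by
      rw [halfTurn_halfTurn]; simp [halfTurn]
    rw [h2, show σ (σ⁻¹ i) = i by simp] at h
    rw [← h, T.isotopic_id.symm.choose_spec.2]
  map_branch i b := by
    obtain ⟨m, hm⟩ := T.map_branch (σ⁻¹ i) (xor b (T.turn (σ⁻¹ i)))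
    refine ⟨-m, ?_⟩
    rw [show σ (σ⁻¹ i) = i by simp] at hm
    simp only [Bool.xor_assoc, Bool.xor_self, Bool.xor_false] at hm
    apply T.ρ.injective
    change T.ρ _ = T.ρ _
    rw [T.ρ_add_int, hm]
    push_cast
    simp

def trans {σ τ : Equiv.Perm (Fin n)} {K K' K'' : SingularKnot M n} (T : RigidIsotopy σ K K')
    (T' : RigidIsotopy τ K' K'') : RigidIsotopy (τ * σ) K K'' where
  θ := T'.θ ∘ T.θ
  isotopic_id := T.isotopic_id.comp T'.isotopic_id
  ρ := T.ρ.trans T'.ρ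
  ρ_strictMono := T'.ρ_strictMono.comp T.ρ_strictMono
  ρ_add_one s := by simp [T.ρ_add_one, T'.ρ_add_one]
  map_curve s := by simp [T.map_curve, T'.map_curve]
  turn i := xor (T.turn i) (T'.turn (σ i))
  map_ball i v hv := by
    simp only [Function.comp_apply, Equiv.Perm.mul_apply]
    rw [T.map_ball i v hv, T'.map_ball _ _ (halfTurn_mem _ hv), halfTurn_halfTurn]
  map_branch i b := by
    obtain ⟨m, hm⟩ := T.map_branch i b
    obtain ⟨m', hm'⟩ := T'.map_branch (σ i) (xor b (T.turn i))
    refine ⟨m' + m, ?_⟩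
    rw [Diffeomorph.coe_trans, Function.comp_apply, hm, T'.ρ_add_int, hm', Bool.xor_assoc]
    push_cast
    simp [add_assoc]

def resolve [T2Space M] {σ : Equiv.Perm (Fin (n + 1))} {K K' : SingularKnot M (n + 1)}
    (T : RigidIsotopy σ K K') (i : Fin (n + 1)) (ε : Bool) (τ : Equiv.Perm (Fin n))
    (hτ : ∀ j, σ (i.succAbove j) = (σ i).succAbove (τ j)) :
    RigidIsotopy τ (K.resolve i ε) (K'.resolve (σ i) ε) where
  θ := T.θ
  isotopic_id := T.isotopic_id
  ρ := T.ρ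
  ρ_strictMono := T.ρ_strictMono
  ρ_add_one := T.ρ_add_one
  map_curve s := by
    change T.θ (K.resolveCurve i ε s) = K'.resolveCurve (σ i) ε (T.ρ s)
    by_cases hs : K.curve s ∈ K.ball i '' Metric.closedBall 0 1
    · obtain ⟨b, u, hu, m, rfl⟩ := K.mem_arc_of_mem_ball i s hs
      obtain ⟨m', hm'⟩ := T.map_arc i b hu
      rw [K.resolveCurve_arc _ _ _ _ hu, T.ρ_add_int, hm', T.map_ball _ _ (strand_mem _ _ hu),
        halfTurn_strand, add_assoc, ← Int.cast_add, K'.resolveCurve_arc _ _ _ _ hu]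
    · rw [K.resolveCurve_of_notMem _ _ hs, T.map_curve, K'.resolveCurve_of_notMem]
      rintro ⟨v, hv, h⟩
      apply hs
      refine ⟨halfTurn (T.turn i) v, halfTurn_mem _ hv, T.θ_injective ?_⟩
      rw [T.map_ball _ _ (halfTurn_mem _ hv), halfTurn_halfTurn, T.map_curve, ← h]
      simp [halfTurn]
  turn j := T.turn (i.succAbove j)
  map_ball j v hv := by
    change T.θ (K.ball (i.succAbove j) v) = K'.ball ((σ i).succAbove (τ j)) _
    rw [← hτ, T.map_ball _ _ hv]
  map_branch j b := by
    change ∃ m : ℤ, T.ρ (K.arc (i.succAbove j) b 0) = K'.arc ((σ i).succAbove (τ j)) _ 0 + m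
    rw [← hτ]
    exact T.map_branch _ b

end RigidIsotopy

theorem exists_perm_succAbove (σ : Equiv.Perm (Fin (n + 1))) (i : Fin (n + 1)) :
    ∃ τ : Equiv.Perm (Fin n), ∀ j, σ (i.succAbove j) = (σ i).succAbove (τ j) := by
  have h : ∀ j, ∃ k, (σ i).succAbove k = σ (i.succAbove j) := fun j =>
    Fin.exists_succAbove_eq fun h => Fin.succAbove_ne i j (σ.injective h)
  choose f hf using h
  have hinj : Function.Injective f := fun j k hjk => by
    apply Fin.succAbove_right_injective (p := i)
    apply σ.injective
    rw [← hf, ← hf, hjk]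
  exact ⟨Equiv.ofBijective f (Finite.injective_iff_bijective.1 hinj), fun j => (hf j).symm⟩

end

/-! ### The sets of singular knots -/

section
variable (M : Type u) [TopologicalSpace M] [ChartedSpace E3 M] (n : ℕ)

/-- Singular knots up to rigid-vertex isotopy, regardless of the labels of the double points. -/
def singularSetoid : Setoid (SingularKnot M n) where
  r K K' := ∃ σ, Nonempty (RigidIsotopy σ K K')
  iseqv :=
    ⟨fun K => ⟨1, ⟨RigidIsotopy.refl K⟩⟩, fun ⟨_, ⟨T⟩⟩ => ⟨_, ⟨T.symm⟩⟩,
      fun ⟨_, ⟨T⟩⟩ ⟨_, ⟨T'⟩⟩ => ⟨_, ⟨T.trans T'⟩⟩⟩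

/-- The set `X_n` of types of `n`-singular knots; `X_0` is the set of oriented knot types. -/
def SingularKnotType : Type u := Quotient (singularSetoid M n)

/-- Singular knots up to order-preserving rigid-vertex isotopy. -/
def orderedSetoid : Setoid (SingularKnot M n) where
  r K K' := Nonempty (RigidIsotopy 1 K K')
  iseqv :=
    ⟨fun K => ⟨RigidIsotopy.refl K⟩, fun ⟨T⟩ => ⟨T.symm⟩, fun ⟨T⟩ ⟨T'⟩ => ⟨T.trans T'⟩⟩

/-- The set `X_n^0` of types of `n`-singular knots with ordered double points. -/
def OrderedKnotType : Type u := Quotient (orderedSetoid M n)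

/-- An `n`-singular knot with a base point away from (the coordinate balls of) the double points. The
double points are labelled in the order in which they are first met when one runs around the knot
from the base point. -/
structure BasedSingularKnot extends SingularKnot M n where
  base : ℝ
  base_notMem : ∀ i, curve base ∉ ball i '' Metric.closedBall 0 1
  natural_order : StrictMono fun i =>
    min (Int.fract (arc i true 0 - base)) (Int.fract (arc i false 0 - base))

/-- Based singular knots up to base point preserving rigid-vertex isotopy. -/
def basedSetoid : Setoid (BasedSingularKnot M n) where
  r K K' := ∃ T : RigidIsotopy 1 K.toSingularKnot K'.toSingularKnot, ∃ m : ℤ,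
    T.ρ K.base = K'.base + m
  iseqv := by
    refine ⟨fun K => ⟨RigidIsotopy.refl _, 0, by simp [RigidIsotopy.refl]⟩, ?_, ?_⟩
    · rintro K K' ⟨T, m, hm⟩
      refine ⟨T.symm, -m, T.ρ.injective ?_⟩
      change T.ρ (T.ρ.symm K'.base) = T.ρ _
      rw [T.ρ_add_int, hm]
      simp
    · rintro K K' K'' ⟨T, m, hm⟩ ⟨T', m', hm'⟩
      refine ⟨T.trans T', m' + m, ?_⟩
      simp only [RigidIsotopy.trans, Diffeomorph.coe_trans, Function.comp_apply]
      rw [hm, T'.ρ_add_int, hm']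
      push_cast; ring

/-- The set `X_n^b` of types of `n`-singular knots with a base point. -/
def BasedKnotType : Type u := Quotient (basedSetoid M n)

end

section
variable {M : Type u} [TopologicalSpace M] [ChartedSpace E3 M] {n : ℕ}

/-- Forget the order of the double points. -/
def OrderedKnotType.forget : OrderedKnotType M n → SingularKnotType M n :=
  Quotient.map' id fun _ _ h => ⟨1, h⟩

/-- Forget the base point (and the order). -/
def BasedKnotType.forget : BasedKnotType M n → SingularKnotType M n :=
  Quotient.map' BasedSingularKnot.toSingularKnot fun _ _ ⟨T, _⟩ => ⟨1, ⟨T⟩⟩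

/-- Resolution of the `i`-th double point on `X_n^0`. -/
def OrderedKnotType.resolve [T2Space M] (ε : Bool) (i : Fin (n + 1)) :
    OrderedKnotType M (n + 1) → OrderedKnotType M n :=
  Quotient.map' (fun K => K.resolve i ε) fun _ _ ⟨T⟩ => ⟨T.resolve i ε 1 fun _ => rfl⟩

/-- Resolution of the `i`-th double point of a based singular knot. -/
def BasedSingularKnot.resolve [T2Space M] (K : BasedSingularKnot M (n + 1)) (i : Fin (n + 1))
    (ε : Bool) : BasedSingularKnot M n where
  toSingularKnot := K.toSingularKnot.resolve i ε
  base := K.base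
  base_notMem j := by
    change K.resolveCurve i ε K.base ∉ _
    rw [K.resolveCurve_of_notMem i ε (K.base_notMem i)]
    exact K.base_notMem _
  natural_order := K.natural_order.comp (Fin.strictMono_succAbove i)

/-- Resolution of the `i`-th double point on `X_n^b`. -/
def BasedKnotType.resolve [T2Space M] (ε : Bool) (i : Fin (n + 1)) :
    BasedKnotType M (n + 1) → BasedKnotType M n :=
  Quotient.map' (fun K => K.resolve i ε) fun _ _ ⟨T, m, hm⟩ =>
    ⟨T.resolve i ε 1 fun _ => rfl, m, hm⟩

/-! ### Extension of knot invariants -/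

/-- The extension of a knot invariant to singular knots by the skein relation, on representatives:
the value is computed by resolving the first double point. -/
def extendAux [T2Space M] (φ : SingularKnotType M 0 → ℚ) : ∀ n, SingularKnot M n → ℚ
  | 0, K => φ (Quotient.mk _ K)
  | n + 1, K => extendAux φ n (K.resolve 0 true) - extendAux φ n (K.resolve 0 false)

/-- The skein relation holds at every double point. -/
theorem extendAux_skein [T2Space M] (φ : SingularKnotType M 0 → ℚ) :
    ∀ n (K : SingularKnot M (n + 1)) (i : Fin (n + 1)),
    extendAux φ (n + 1) K = extendAux φ n (K.resolve i true) - extendAux φ n (K.resolve i false) := by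
  intro n
  induction n with
  | zero => intro K i; rw [show i = 0 from Fin.ext (by omega)]; rfl
  | succ n ih =>
    intro K i
    refine Fin.cases rfl (fun j => ?_) i
    rw [show extendAux φ (n + 2) K = extendAux φ (n + 1) (K.resolve 0 true) -
      extendAux φ (n + 1) (K.resolve 0 false) from rfl, ih _ j, ih _ j, ih _ 0, ih _ 0]
    have h : ∀ ε δ, (K.resolve j.succ ε).resolve 0 δ = (K.resolve 0 δ).resolve j ε := fun ε δ =>
      K.resolve_resolve (Fin.zero_le j) ε δ
    simp only [h]
    ring

theorem extendAux_congr [T2Space M] (φ : SingularKnotType M 0 → ℚ) :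
    ∀ n (K K' : SingularKnot M n), (singularSetoid M n).r K K' →
    extendAux φ n K = extendAux φ n K' := by
  intro n
  induction n with
  | zero => intro K K' h; exact congrArg φ (Quotient.sound h)
  | succ n ih =>
    rintro K K' ⟨σ, ⟨T⟩⟩
    obtain ⟨τ, hτ⟩ := exists_perm_succAbove σ 0
    rw [extendAux_skein φ n K 0, extendAux_skein φ n K' (σ 0)]
    congr 1
    · exact ih _ _ ⟨τ, ⟨T.resolve 0 true τ hτ⟩⟩
    · exact ih _ _ ⟨τ, ⟨T.resolve 0 false τ hτ⟩⟩

/-- The extension of a knot invariant `φ : X_0 → ℚ` to an invariant `X_n → ℚ` of `n`-singular knots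
by the skein relation. -/
def extend [T2Space M] (φ : SingularKnotType M 0 → ℚ) (n : ℕ) : SingularKnotType M n → ℚ :=
  Quotient.lift (extendAux φ n) (extendAux_congr φ n)

/-- `φ` is a Vassiliev invariant of order at most `N`: its extension vanishes on all `(N + 1)`-singular
knots. -/
def IsVassilievOfOrderLE [T2Space M] (φ : SingularKnotType M 0 → ℚ) (N : ℕ) : Prop :=
  ∀ K : SingularKnotType M (N + 1), extend φ (N + 1) K = 0

end

/-! ### Cubical complexes -/

/-- A set of cubes with their faces. `face true i K` and `face false i K` are the faces of the cube
`K` where its `i`-th coordinate is `+1` and `-1`. -/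
structure CubicalSet where
  cell : ℕ → Type u
  face : ∀ {n : ℕ}, Bool → Fin (n + 1) → cell (n + 1) → cell n
  face_face : ∀ {n : ℕ} (ε δ : Bool) {i j : Fin (n + 1)}, i ≤ j → ∀ K : cell (n + 2),
    face δ i (face ε j.succ K) = face ε j (face δ i.castSucc K)

namespace CubicalSet
variable (X : CubicalSet.{u})

/-- A cube of positive dimension is degenerate if `d_i K = 0` for some `i`, where
`d_i K = face true i K - face false i K`. There are no degenerate vertices, that is, `C_0(D) = 0`. -/
def degenerate : ∀ n, Set (X.cell n)
  | 0 => ∅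
  | _ + 1 => {K | ∃ i, X.face true i K = X.face false i K}

/-- The coboundary, dual to the cellular boundary `∂ K = ∑ (-1)^i d_i K`. The index `i` starts at `0`
here. -/
def coboundary (n : ℕ) : (X.cell n → ℚ) →ₗ[ℚ] (X.cell (n + 1) → ℚ) where
  toFun ψ K := ∑ i : Fin (n + 1), (-1) ^ (i : ℕ) * (ψ (X.face true i K) - ψ (X.face false i K))
  map_add' ψ χ := by
    funext K
    simp only [Pi.add_apply, ← Finset.sum_add_distrib]
    exact Finset.sum_congr rfl fun i _ => by ring
  map_smul' c ψ := by
    funext K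
    simp only [Pi.smul_apply, smul_eq_mul, RingHom.id_apply, Finset.mul_sum]
    exact Finset.sum_congr rfl fun i _ => by ring

/-- The relative cochains `C^n(X, D; ℚ)`: rational functions on the set of `n`-cubes, that is, linear
functions on the space `C_n(X)` which they span, that vanish on the degenerate ones. -/
def relCochains (n : ℕ) : Submodule ℚ (X.cell n → ℚ) where
  carrier := {ψ | ∀ K ∈ X.degenerate n, ψ K = 0}
  zero_mem' _ _ := rfl
  add_mem' {ψ χ} h h' K hK := by
    rw [Pi.add_apply, h K hK, h' K hK, add_zero]
  smul_mem' c ψ h K hK := by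
    rw [Pi.smul_apply, h K hK, smul_zero]

theorem face_mem_degenerate {n : ℕ} {K : X.cell (n + 2)} {i j : Fin (n + 2)}
    (h : X.face true i K = X.face false i K) (hij : j ≠ i) (ε : Bool) :
    X.face ε j K ∈ X.degenerate (n + 1) := by
  rcases lt_or_gt_of_ne hij with hlt | hlt
  · obtain ⟨i, rfl⟩ := Fin.eq_succ_of_ne_zero (Fin.ne_zero_of_lt hlt)
    obtain ⟨j, rfl⟩ := Fin.eq_castSucc_of_ne_last (Fin.ne_last_of_lt hlt)
    have hle : j ≤ i := Fin.le_def.2 (Nat.lt_succ_iff.1 (Fin.lt_def.1 hlt))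
    exact ⟨i, by rw [← X.face_face _ _ hle, ← X.face_face _ _ hle, h]⟩
  · obtain ⟨j, rfl⟩ := Fin.eq_succ_of_ne_zero (Fin.ne_zero_of_lt hlt)
    obtain ⟨i, rfl⟩ := Fin.eq_castSucc_of_ne_last (Fin.ne_last_of_lt hlt)
    have hle : i ≤ j := Fin.le_def.2 (Nat.lt_succ_iff.1 (Fin.lt_def.1 hlt))
    exact ⟨i, by rw [X.face_face _ _ hle, X.face_face _ _ hle, h]⟩

/-- The degenerate cubes span a subcomplex, so the coboundary preserves relative cochains. -/
theorem coboundary_mem {n : ℕ} {ψ : X.cell n → ℚ} (hψ : ψ ∈ X.relCochains n) :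
    X.coboundary n ψ ∈ X.relCochains (n + 1) := by
  rintro K ⟨i, hi⟩
  change ∑ j : Fin (n + 1), (-1) ^ (j : ℕ) *
    (ψ (X.face true j K) - ψ (X.face false j K)) = 0
  refine Finset.sum_eq_zero fun j _ => ?_
  by_cases hji : j = i
  · subst hji; rw [hi]; simp
  · cases n with
    | zero => exact absurd (Fin.ext (by omega)) hji
    | succ n =>
      rw [hψ _ (X.face_mem_degenerate hi hji true), hψ _ (X.face_mem_degenerate hi hji false)]
      simp

theorem coboundary_coboundary (n : ℕ) (ψ : X.cell n → ℚ) :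
    X.coboundary (n + 1) (X.coboundary n ψ) = 0 := by
  funext K
  let d : Fin (n + 2) → Fin (n + 1) → ℚ := fun i j =>
    (ψ (X.face true j (X.face true i K)) - ψ (X.face false j (X.face true i K))) -
      (ψ (X.face true j (X.face false i K)) - ψ (X.face false j (X.face false i K)))
  have hd : ∀ i j : Fin (n + 1), i ≤ j → d j.succ i = d i.castSucc j := by
    intro i j hij
    simp only [d, X.face_face _ _ hij]
    ring
  have h : X.coboundary (n + 1) (X.coboundary n ψ) K =
      ∑ p : Fin (n + 2) × Fin (n + 1), (-1 : ℚ) ^ (p.1 + p.2 : ℕ) * d p.1 p.2 := by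
    rw [Fintype.sum_prod_type]
    change ∑ i : Fin (n + 2), (-1) ^ (i : ℕ) * (X.coboundary n ψ (X.face true i K) -
      X.coboundary n ψ (X.face false i K)) = _
    refine Finset.sum_congr rfl fun i _ => ?_
    simp only [coboundary, LinearMap.coe_mk, AddHom.coe_mk]
    rw [← Finset.sum_sub_distrib, Finset.mul_sum]
    refine Finset.sum_congr rfl fun j _ => ?_
    simp only [d, pow_add]
    ring
  rw [h]
  let P := Fin (n + 2) × Fin (n + 1)
  let S : Finset P := {ij : P | (ij.2 : ℕ) < (ij.1 : ℕ)}
  rw [Pi.zero_apply, ← Finset.sum_add_sum_compl S, ← eq_neg_iff_add_eq_zero,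
    ← Finset.sum_neg_distrib]
  let f : ∀ ij : P, ij ∈ S → P := fun ij hij =>
    (Fin.castSucc ij.2, ij.1.pred fun h0 => by simp [S, h0] at hij)
  refine Finset.sum_bij f ?_ ?_ ?_ ?_
  · rintro ⟨i, j⟩ hij
    simp only [S, f, Finset.compl_filter, Finset.mem_filter_univ, Fin.val_castSucc,
      Fin.val_pred] at hij ⊢
    lia
  · rintro ⟨i, j⟩ hij ⟨i', j'⟩ hij' h
    obtain ⟨h1, h2⟩ := Prod.mk.inj (h : (Fin.castSucc j, _) = (Fin.castSucc j', _))
    exact Prod.ext (Fin.pred_inj.1 h2) (Fin.castSucc_injective _ h1)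
  · rintro ⟨i', j'⟩ hij'
    simp only [S, Finset.compl_filter, Finset.mem_filter_univ, not_lt] at hij'
    have hlt : (i' : ℕ) < n + 1 := by have := j'.2; lia
    refine ⟨(j'.succ, i'.castLT hlt), ?_, ?_⟩
    · simp only [S, Finset.mem_filter_univ, Fin.val_succ, Fin.val_castLT]
      lia
    · simp [f]
  · rintro ⟨i, j⟩ hij
    have hi0 : i ≠ 0 := fun h0 => by simp [S, h0] at hij
    obtain ⟨i, rfl⟩ := Fin.eq_succ_of_ne_zero hi0
    have hle : j ≤ i := by
      simp only [S, Finset.mem_filter_univ, Fin.val_succ] at hij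
      exact Fin.le_def.2 (by lia)
    simp only [f, Fin.pred_succ, Fin.val_castSucc, Fin.val_succ]
    rw [hd j i hle]
    ring

/-- The relative cocycles `Z^n(X, D; ℚ)`. -/
def relCocycles (n : ℕ) : Submodule ℚ (X.cell n → ℚ) :=
  X.relCochains n ⊓ LinearMap.ker (X.coboundary n)

/-- The relative coboundaries `B^n(X, D; ℚ)`. -/
def relCoboundaries : ∀ n, Submodule ℚ (X.cell n → ℚ)
  | 0 => ⊥
  | n + 1 => (X.relCochains n).map (X.coboundary n)

theorem relCoboundaries_le (n : ℕ) : X.relCoboundaries n ≤ X.relCocycles n := by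
  cases n with
  | zero => exact bot_le
  | succ n =>
    rintro _ ⟨ψ, hψ, rfl⟩
    exact ⟨X.coboundary_mem hψ, X.coboundary_coboundary n ψ⟩

/-- The relative cohomology `H^n(X, D; ℚ) = Z^n(X, D; ℚ) / B^n(X, D; ℚ)`. -/
abbrev relCohomology (n : ℕ) : Type u :=
  X.relCocycles n ⧸ (X.relCoboundaries n).submoduleOf (X.relCocycles n)

/-- The cohomology class of a relative cocycle. -/
def relClass {n : ℕ} (c : X.relCocycles n) : X.relCohomology n := Submodule.Quotient.mk c

end CubicalSet

section
variable (M : Type u) [TopologicalSpace M] [ChartedSpace E3 M] [T2Space M]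

/-- The cubical complex `CK_0(M)`, whose `n`-cubes are the types of `n`-singular knots with ordered
double points, and whose faces are the resolutions. -/
def orderedComplex : CubicalSet.{u} where
  cell := OrderedKnotType M
  face := OrderedKnotType.resolve
  face_face ε δ i j hij K := by
    induction K using Quotient.inductionOn with
    | h K => exact congrArg (Quotient.mk _) (K.resolve_resolve hij ε δ)

/-- The cubical complex `CK_b(M)`, whose `n`-cubes are the types of based `n`-singular knots, and whose
faces are the resolutions. -/
def basedComplex : CubicalSet.{u} where
  cell := BasedKnotType M
  face := BasedKnotType.resolve
  face_face ε δ i j hij K := by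
    induction K using Quotient.inductionOn with
    | h K =>
      refine congrArg (Quotient.mk _) ?_
      have := K.toSingularKnot.resolve_resolve hij ε δ
      cases K
      simp only [BasedSingularKnot.resolve] at this ⊢
      congr 1

variable {M}

/-- The restriction to `n`-singular knots of the extension of a knot invariant, as a cochain of
`CK_0(M)`, by forgetting the order. -/
def orderedRestriction (φ : SingularKnotType M 0 → ℚ) (n : ℕ) : (orderedComplex M).cell n → ℚ :=
  fun K : OrderedKnotType M n => extend φ n K.forget

/-- The restriction to `n`-singular knots of the extension of a knot invariant, as a cochain of
`CK_b(M)`, by forgetting the base point. -/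
def basedRestriction (φ : SingularKnotType M 0 → ℚ) (n : ℕ) : (basedComplex M).cell n → ℚ :=
  fun K : BasedKnotType M n => extend φ n K.forget

end

end KnotComplex

end

/-!
By the skein relation, the extension `φ` of a knot invariant takes the same value `φ K` on all the
differences `d_i K` of an `(n + 1)`-cube `K`. So the coboundary of its restriction to `n`-cubes,
evaluated at `K`, is an alternating sum of `n + 1` copies of `φ K`: it is `0` when `n` is odd and
`φ K` when `n` is even. Thus the cochain in degree `2k + 1` is a cocycle, and it is the coboundary of
the cochain in degree `2k`. All of these cochains vanish on degenerate cubes, again by the skein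
relation, so this happens in the relative complex. The argument applies to every family of cochains
on a cubical set that satisfies the skein relation in all directions (`CubicalSet.IsSkein`), and both
`CK_0` and `CK_b` carry such a family (`isSkein_orderedRestriction`, `isSkein_basedRestriction`).
-/

namespace KnotComplex

universe v

/-- A family of cochains, one in each degree, which satisfies the skein relation in all directions:
`ψ_{n+1}(K) = ψ_n(d_i K)` for every cube `K` and every `i`. -/
def CubicalSet.IsSkein (X : CubicalSet.{v}) (ψ : ∀ n, X.cell n → ℚ) : Prop :=
  ∀ (n : ℕ) (i : Fin (n + 1)) (K : X.cell (n + 1)),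
    ψ (n + 1) K = ψ n (X.face true i K) - ψ n (X.face false i K)

namespace CubicalSet.IsSkein

variable {X : CubicalSet.{v}} {ψ : ∀ n, X.cell n → ℚ}

theorem mem_relCochains (h : X.IsSkein ψ) (n : ℕ) : ψ n ∈ X.relCochains n := by
  cases n with
  | zero => exact fun K hK => hK.elim
  | succ n =>
    rintro K ⟨i, hi⟩
    rw [h n i K, hi, sub_self]

theorem coboundary_apply (h : X.IsSkein ψ) (n : ℕ) (K : X.cell (n + 1)) :
    X.coboundary n (ψ n) K = (∑ i : Fin (n + 1), (-1) ^ (i : ℕ)) * ψ (n + 1) K := by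
  rw [Finset.sum_mul]
  change ∑ i : Fin (n + 1),
    (-1) ^ (i : ℕ) * (ψ n (X.face true i K) - ψ n (X.face false i K)) = _
  exact Finset.sum_congr rfl fun i _ => by rw [h n i K]

theorem coboundary_of_odd (h : X.IsSkein ψ) {n : ℕ} (hn : Odd n) : X.coboundary n (ψ n) = 0 := by
  funext K
  rw [h.coboundary_apply, Fin.sum_neg_one_pow, if_pos hn.add_one, zero_mul, Pi.zero_apply]

theorem coboundary_of_even (h : X.IsSkein ψ) {n : ℕ} (hn : Even n) :
    X.coboundary n (ψ n) = ψ (n + 1) := by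
  funext K
  rw [h.coboundary_apply, Fin.sum_neg_one_pow,
    if_neg (Nat.not_even_iff_odd.2 hn.add_one), one_mul]

theorem exists_relClass_eq_zero (h : X.IsSkein ψ) (k : ℕ) :
    ∃ hc : ψ (2 * k + 1) ∈ X.relCocycles (2 * k + 1), X.relClass ⟨_, hc⟩ = 0 := by
  refine ⟨⟨h.mem_relCochains _, h.coboundary_of_odd (odd_two_mul_add_one k)⟩, ?_⟩
  refine (Submodule.Quotient.mk_eq_zero _).2 (Submodule.mem_comap.2 ?_)
  exact ⟨ψ (2 * k), h.mem_relCochains _, h.coboundary_of_even (even_two_mul k)⟩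

end CubicalSet.IsSkein

variable {M : Type v} [TopologicalSpace M] [ChartedSpace E3 M] [T2Space M]

theorem isSkein_orderedRestriction (φ : SingularKnotType M 0 → ℚ) :
    (orderedComplex M).IsSkein (orderedRestriction φ) := fun n i K =>
  Quotient.inductionOn K fun K => extendAux_skein φ n K i

theorem isSkein_basedRestriction (φ : SingularKnotType M 0 → ℚ) :
    (basedComplex M).IsSkein (basedRestriction φ) := fun n i K =>
  Quotient.inductionOn K fun K => extendAux_skein φ n K.toSingularKnot i

end KnotComplex

theorem theorem5p8 (M : Type*) [TopologicalSpace M] [T2Space M] [SecondCountableTopology M]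
    [ChartedSpace KnotComplex.E3 M] [IsManifold (𝓡 3) ∞ M] [KnotComplex.OrientedAtlas M]
    [SimplyConnectedSpace M] (hpi₂ : ∀ x : M, Subsingleton (HomotopyGroup.Pi 2 M x))
    (φ : KnotComplex.SingularKnotType M 0 → ℚ) (N : ℕ)
    (hφ : KnotComplex.IsVassilievOfOrderLE φ N) (k : ℕ) :
    (∃ h : KnotComplex.orderedRestriction φ (2 * k + 1) ∈
          (KnotComplex.orderedComplex M).relCocycles (2 * k + 1),
        (KnotComplex.orderedComplex M).relClass ⟨_, h⟩ = 0) ∧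
      ∃ h : KnotComplex.basedRestriction φ (2 * k + 1) ∈
          (KnotComplex.basedComplex M).relCocycles (2 * k + 1),
        (KnotComplex.basedComplex M).relClass ⟨_, h⟩ = 0 :=
  ⟨(KnotComplex.isSkein_orderedRestriction φ).exists_relClass_eq_zero k,
    (KnotComplex.isSkein_basedRestriction φ).exists_relClass_eq_zero k⟩
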